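/- Let $k$ be a field of characteristic $0$, let $G\ge 1$, let $X^{(i)}=\{X^{(i)}_1,\dots,X^{(i)}_{g_i}\}$ ($1\le i\le G$) be finite sets of freely noncommuting variables and $X=\bigcup_i X^{(i)}$. Let $\mathcal R_k(X)$ be the set of formal noncommutative rational expressions over $k$ in $X$ (built from scalars and variables by $+$, $\cdot$ and inversion). Given $n_1,\dots,n_G\ge 1$ and a tuple $a=(a^{(i)}_j)$ with $a^{(i)}_j\in M_{n_i}(k)$, an expression $r$ is mp-defined at $a$ if it can be evaluated at the tuple of matrices $\tau_i(a^{(i)}_j)=I_{n_1}\otimes\cdots\otimes a^{(i)}_j\otimes\cdots\otimes I_{n_G}$ ($a^{(i)}_j$ in the $i$-th factor, $\otimes$ the Kronecker product), i.e. if every inversion in $r$ is applied to an invertible matrix; the value is denoted $r(a)^{\mathrm{mp}}$. Call $r$ mp-nondegenerate if it is mp-defined at some $a$ of some sizes $n_1,\dots,n_G\ge1$, and for mp-nondegenerate $r_1,r_2$ write $r_1\sim r_2$ if $r_1(a)^{\mathrm{mp}}=r_2(a)^{\mathrm{mp}}$ whenever both are mp-defined at $a$. The equivalence classes of mp-nondegenerate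 expressions, with the operations induced from expressions, form the $k$-algebra $k(\!\langle X^{(1)};\dots;X^{(G)}\rangle\!)$ of multipartite (mp) rational functions. Fix $1\le i\le G$ and $1\le j\le g_i$, and let $X'^{(i)}=\{X'^{(i)}_1,\dots,X'^{(i)}_{g_i}\}$ be a copy of $X^{(i)}$. Define $\Delta^{(i)}_j\colon\mathcal R_k(X)\to\mathcal R_k(X'^{(i)}\cup X)$ recursively by $$\Delta^{(i)}_j(\alpha)=0\ (\alpha\in k),\qquad \Delta^{(i)}_j(X^{(i)}_j)=1,\qquad \Delta^{(i)}_j(X^{(l)}_m)=0\ \text{ if } (l,m)\ne(i,j),$$ $$\Delta^{(i)}_j(r+s)=\Delta^{(i)}_j(r)+\Delta^{(i)}_j(s),\qquad \Delta^{(i)}_j(rs)=r'\,\Delta^{(i)}_j(s)+\Delta^{(i)}_j(r)\,s,\qquad \Delta^{(i)}_j(r^{-1})=-(r')^{-1}\,\Delta^{(i)}_j(r)\,r^{-1},$$ where $r'=r(\dots,X'^{(i)},\dots)$ is obtained from $r$ by replacing every $X^{(i)}_m$ by $X'^{(i)}_m$. View $B=k(\!\langle X^{(1)};\dots;X'^{(i)};X^{(i)};\dots;X^{(G)}\rangle\!)$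 (mp rational functions in $G+1$ sets of variables) as a bimodule over $A=k(\!\langle X^{(1)};\dots;X^{(G)}\rangle\!)$ with actions $\mathbf r\cdot\mathbf s=\mathbf r(\dots,X'^{(i)},\dots)\,\mathbf s$ and $\mathbf s\cdot\mathbf r=\mathbf s\,\mathbf r$ for $\mathbf r\in A$, $\mathbf s\in B$. Then $\Delta^{(i)}_j$ maps mp-nondegenerate expressions to mp-nondegenerate expressions and preserves $\sim$, and the induced map $\Delta^{(i)}_j\colon A\to B$ is a $k$-linear derivation: it is $k$-linear and $\Delta^{(i)}_j(\mathbf r\mathbf s)=\mathbf r\cdot\Delta^{(i)}_j(\mathbf s)+\Delta^{(i)}_j(\mathbf r)\cdot\mathbf s$ for all $\mathbf r,\mathbf s\in A$. -/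

import Mathlib

open scoped Kronecker RightActions

noncomputable section

/-- Formal noncommutative rational expressions over `k` in the variables `V`: all valid
combinations of scalars, variables, addition, multiplication and inversion. -/
inductive RatExpr (k : Type*) (V : Type*) where
  | const : k → RatExpr k V
  | var : V → RatExpr k V
  | add : RatExpr k V → RatExpr k V → RatExpr k V
  | mul : RatExpr k V → RatExpr k V → RatExpr k V
  | inv : RatExpr k V → RatExpr k V

namespace RatExpr

variable {k : Type*} {V W : Type*}

/-- The expression `-r`. -/
def neg [One k] [Neg k] (r : RatExpr k V) : RatExpr k V := mul (const (-1)) r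

/-- Substitution of variables by variables. -/
def rename (f : V → W) : RatExpr k V → RatExpr k W
  | const c => const c
  | var v => var (f v)
  | add r s => add (rename f r) (rename f s)
  | mul r s => mul (rename f r) (rename f s)
  | inv r => inv (rename f r)

section Eval

variable [Field k] {A B : Type*} [Ring A] [Algebra k A] [Ring B] [Algebra k B]

/-- The value of an expression at a tuple of elements of a `k`-algebra; it is meaningful only where
the expression is defined, see `RatExpr.DefinedAt`. -/
def eval (a : V → A) : RatExpr k V → A
  | const c => algebraMap k A c
  | var v => a v
  | add r s => eval a r + eval a s
  | mul r s => eval a r * eval a s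
  | inv r => Ring.inverse (eval a r)

/-- An expression is defined at `a` if every inversion in it is applied to an invertible value. -/
def DefinedAt (a : V → A) : RatExpr k V → Prop
  | const _ => True
  | var _ => True
  | add r s => DefinedAt a r ∧ DefinedAt a s
  | mul r s => DefinedAt a r ∧ DefinedAt a s
  | inv r => DefinedAt a r ∧ IsUnit (eval a r)

theorem eval_rename (f : V → W) (a : W → A) (r : RatExpr k V) :
    (r.rename f).eval a = r.eval (a ∘ f) := by
  induction r with
  | const c => rfl
  | var v => rfl
  | add r s hr hs => simp [rename, eval, hr, hs]
  | mul r s hr hs => simp [rename, eval, hr, hs]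
  | inv r hr => simp [rename, eval, hr]

theorem definedAt_rename (f : V → W) (a : W → A) (r : RatExpr k V) :
    (r.rename f).DefinedAt a ↔ r.DefinedAt (a ∘ f) := by
  induction r with
  | const c => rfl
  | var v => rfl
  | add r s hr hs => simp [rename, DefinedAt, hr, hs]
  | mul r s hr hs => simp [rename, DefinedAt, hr, hs]
  | inv r hr => simp [rename, DefinedAt, hr, eval_rename]

theorem map_eval (φ : A →ₐ[k] B) (a : V → A) (r : RatExpr k V)
    (h : r.DefinedAt a) : r.DefinedAt (φ ∘ a) ∧ r.eval (φ ∘ a) = φ (r.eval a) := by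
  induction r with
  | const c => simp [DefinedAt, eval]
  | var v => simp [DefinedAt, eval]
  | add r s hr hs =>
    obtain ⟨h1, h2⟩ := hr h.1
    obtain ⟨h3, h4⟩ := hs h.2
    exact ⟨⟨h1, h3⟩, by simp [eval, h2, h4]⟩
  | mul r s hr hs =>
    obtain ⟨h1, h2⟩ := hr h.1
    obtain ⟨h3, h4⟩ := hs h.2
    exact ⟨⟨h1, h3⟩, by simp [eval, h2, h4]⟩
  | inv r hr =>
    obtain ⟨h1, h2⟩ := hr h.1
    obtain ⟨u, hu⟩ := h.2
    have hv : r.eval (φ ∘ a) = (Units.map (φ : A →* B) u : Bˣ) := by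
      rw [h2, ← hu]; rfl
    refine ⟨⟨h1, hv ▸ Units.isUnit _⟩, ?_⟩
    simp only [eval]
    rw [hv, ← hu, Ring.inverse_unit, Ring.inverse_unit, ← map_inv]
    rfl

theorem definedAt_of_map (φ : A →ₐ[k] B) (hφ : ∀ x, IsUnit (φ x) → IsUnit x) (a : V → A)
    (r : RatExpr k V) (h : r.DefinedAt (φ ∘ a)) : r.DefinedAt a := by
  induction r with
  | const c => trivial
  | var v => trivial
  | add r s hr hs => exact ⟨hr h.1, hs h.2⟩
  | mul r s hr hs => exact ⟨hr h.1, hs h.2⟩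
  | inv r hr =>
    have h1 := hr h.1
    refine ⟨h1, hφ _ ?_⟩
    rw [← (map_eval φ a r h1).2]
    exact h.2

end Eval

end RatExpr

/-! ### Multipartite evaluations

A set of variables partitioned into parts indexed by `ι` is given by a map `π : V → ι`. Matrices of
size `∏ i, n i` have their rows and columns indexed by multi-indices `(i : ι) → Fin (n i)`. -/

section Multipartite

variable {k : Type*} [Field k] {ι κ V W : Type} [Fintype ι] [DecidableEq ι] [Fintype κ]
  [DecidableEq κ]

/-- Square matrices of size `∏ i, n i`. -/
abbrev MPMatrix (k : Type*) (n : ι → ℕ) : Type _ :=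
  Matrix ((i : ι) → Fin (n i)) ((i : ι) → Fin (n i)) k

/-- The Kronecker product of a family of square matrices of sizes `n i`. -/
def kron {n : ι → ℕ} (c : (i : ι) → Matrix (Fin (n i)) (Fin (n i)) k) : MPMatrix k n :=
  Matrix.of fun p q => ∏ l, c l (p l) (q l)

/-- The embedding `a ↦ I ⊗ ⋯ ⊗ a ⊗ ⋯ ⊗ I`, with `a` in the `i`-th factor. -/
def kronEmb {n : ι → ℕ} (i : ι) (a : Matrix (Fin (n i)) (Fin (n i)) k) : MPMatrix k n :=
  kron (Function.update (fun _ => 1) i a)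

/-- Tuples of matrices in which the variables of the `i`-th part have size `n i`. -/
abbrev MPPoint (k : Type*) (π : V → ι) (n : ι → ℕ) : Type _ :=
  (v : V) → Matrix (Fin (n (π v))) (Fin (n (π v))) k

/-- The tuple of commuting (across different parts) matrices of size `∏ i, n i` obtained by putting
the matrices of the `i`-th part into the `i`-th tensor factor. -/
def kronTuple (π : V → ι) {n : ι → ℕ} (a : MPPoint k π n) : V → MPMatrix k n :=
  fun v => kronEmb (π v) (a v)

/-- `r` is mp-defined at `a`. -/
def MPDefinedAt (π : V → ι) {n : ι → ℕ} (r : RatExpr k V) (a : MPPoint k π n) : Prop :=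
  r.DefinedAt (kronTuple π a)

/-- The mp-evaluation of `r` at `a`. -/
def mpEval (π : V → ι) {n : ι → ℕ} (r : RatExpr k V) (a : MPPoint k π n) : MPMatrix k n :=
  r.eval (kronTuple π a)

/-- `r` is mp-nondegenerate: it is mp-defined at some tuple of matrices (of positive sizes). -/
def MPNondegenerate (π : V → ι) (r : RatExpr k V) : Prop :=
  ∃ n : ι → ℕ, (∀ i, 0 < n i) ∧ ∃ a : MPPoint k π n, MPDefinedAt π r a

/-- `r` and `s` have the same mp-evaluations wherever both are mp-defined. -/
def MPEquiv (π : V → ι) (r s : RatExpr k V) : Prop :=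
  ∀ n : ι → ℕ, (∀ i, 0 < n i) → ∀ a : MPPoint k π n,
    MPDefinedAt π r a → MPDefinedAt π s a → mpEval π r a = mpEval π s a

theorem kronEmb_apply {n : ι → ℕ} (i : ι) (a : Matrix (Fin (n i)) (Fin (n i)) k)
    (p q : (i : ι) → Fin (n i)) :
    kronEmb i a p q = if ∀ j, j ≠ i → p j = q j then a (p i) (q i) else 0 := by
  unfold kronEmb kron
  rw [Matrix.of_apply, ← Finset.mul_prod_erase Finset.univ _ (Finset.mem_univ i)]
  rw [Function.update_self]
  split_ifs with h
  · rw [Finset.prod_eq_one, mul_one]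
    intro j hj
    have hj' := Finset.ne_of_mem_erase hj
    rw [Function.update_of_ne hj', h j hj', Matrix.one_apply_eq]
  · push Not at h
    obtain ⟨j, hj, hne⟩ := h
    rw [Finset.prod_eq_zero (i := j) (by simp [hj]), mul_zero]
    rw [Function.update_of_ne hj, Matrix.one_apply_ne hne]

section Blow

variable {P P' Q : Type} [Fintype P] [DecidableEq P] [Fintype P'] [DecidableEq P'] [Fintype Q]
  [DecidableEq Q]

/-- The embedding `M ↦ M ⊗ I` of matrix algebras, with respect to a decomposition of indices. -/
def blowUp (e : P' ≃ P × Q) : Matrix P P k →ₐ[k] Matrix P' P' k :=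
  AlgHom.ofLinearMap
    { toFun := fun M => (M ⊗ₖ (1 : Matrix Q Q k)).submatrix e e
      map_add' := by
        intro M N
        rw [Matrix.add_kronecker]; rfl
      map_smul' := by
        intro c M
        rw [Matrix.smul_kronecker]; rfl }
    (by simp)
    (by
      intro M N
      change ((M * N) ⊗ₖ (1 : Matrix Q Q k)).submatrix e e =
        (M ⊗ₖ (1 : Matrix Q Q k)).submatrix e e * (N ⊗ₖ (1 : Matrix Q Q k)).submatrix e e
      rw [Matrix.submatrix_mul_equiv, ← Matrix.mul_kronecker_mul, one_mul])

theorem blowUp_def (e : P' ≃ P × Q) (M : Matrix P P k) :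
    blowUp e M = (M ⊗ₖ (1 : Matrix Q Q k)).submatrix e e := rfl

theorem blowUp_apply (e : P' ≃ P × Q) (M : Matrix P P k) (p q : P') :
    blowUp e M p q = if (e p).2 = (e q).2 then M (e p).1 (e q).1 else 0 := by
  rw [blowUp_def, Matrix.submatrix_apply, Matrix.kroneckerMap_apply, Matrix.one_apply]
  simp

theorem blowUp_injective (e : P' ≃ P × Q) (hQ : Nonempty Q) :
    Function.Injective (blowUp (k := k) e) := by
  intro M N h
  obtain ⟨q⟩ := hQ
  ext x y
  have := congrFun (congrFun h (e.symm (x, q))) (e.symm (y, q))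
  simpa [blowUp_apply] using this

theorem isUnit_of_blowUp (e : P' ≃ P × Q) (hQ : Nonempty Q) (M : Matrix P P k)
    (h : IsUnit (blowUp e M)) : IsUnit M := by
  rw [Matrix.isUnit_iff_isUnit_det] at h ⊢
  rw [blowUp_def, Matrix.det_submatrix_equiv_self, Matrix.det_kronecker] at h
  exact (isUnit_pow_iff Fintype.card_ne_zero).1 (isUnit_of_mul_isUnit_left h)

end Blow

section Up

/-- Decomposition of multi-indices induced by decompositions of the indices. -/
def piSplit {N n m : ι → ℕ} (ε : ∀ i, Fin (N i) ≃ Fin (n i) × Fin (m i)) :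
    ((i : ι) → Fin (N i)) ≃ ((i : ι) → Fin (n i)) × ((i : ι) → Fin (m i)) where
  toFun p := (fun i => (ε i (p i)).1, fun i => (ε i (p i)).2)
  invFun pq := fun i => (ε i).symm (pq.1 i, pq.2 i)
  left_inv p := by ext i; simp
  right_inv pq := by simp

/-- The tuple with `a v` replaced by `a v ⊗ I`. -/
def upPoint {N n m : ι → ℕ} (π : V → ι) (ε : ∀ i, Fin (N i) ≃ Fin (n i) × Fin (m i))
    (a : MPPoint k π n) : MPPoint k π N := fun v => blowUp (ε (π v)) (a v)

theorem kronTuple_upPoint {N n m : ι → ℕ} (π : V → ι)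
    (ε : ∀ i, Fin (N i) ≃ Fin (n i) × Fin (m i)) (a : MPPoint k π n) :
    kronTuple π (upPoint π ε a) = blowUp (piSplit ε) ∘ kronTuple π a := by
  funext v
  ext p q
  simp only [kronTuple, upPoint, Function.comp_apply, kronEmb_apply, blowUp_apply, ← ite_and]
  refine if_congr ?_ rfl rfl
  simp only [piSplit, Equiv.coe_fn_mk]
  constructor
  · rintro ⟨h1, h2⟩
    refine ⟨funext fun j => ?_, fun j hj => by rw [h1 j hj]⟩
    by_cases hj : j = π v
    · subst hj; exact h2
    · rw [h1 j hj]
  · rintro ⟨h1, h2⟩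
    exact ⟨fun j hj => (ε j).injective (Prod.ext (h2 j hj) (congrFun h1 j)), congrFun h1 _⟩

theorem mp_up {N n m : ι → ℕ} (π : V → ι)
    (ε : ∀ i, Fin (N i) ≃ Fin (n i) × Fin (m i)) (r : RatExpr k V) (a : MPPoint k π n)
    (h : MPDefinedAt π r a) :
    MPDefinedAt π r (upPoint π ε a) ∧
      mpEval π r (upPoint π ε a) = blowUp (piSplit ε) (mpEval π r a) := by
  unfold MPDefinedAt mpEval
  rw [kronTuple_upPoint]
  exact RatExpr.map_eval _ _ _ h

end Up

section Line

open Polynomial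

theorem kronEmb_line {n : ι → ℕ} (i : ι) (a b : Matrix (Fin (n i)) (Fin (n i)) k) (t : k) :
    kronEmb i (a + t • (b - a)) = kronEmb i a + t • (kronEmb i b - kronEmb i a) := by
  ext p q
  simp only [kronEmb_apply, Matrix.add_apply, Matrix.smul_apply, Matrix.sub_apply]
  split_ifs <;> simp

/-- Along a line, an expression is a quotient of a polynomial matrix by a polynomial. -/
theorem RatExpr.line {P : Type} [Fintype P] [DecidableEq P] (A B : V → Matrix P P k) (t₀ : k)
    (r : RatExpr k V) (h : r.DefinedAt (fun v => A v + t₀ • (B v - A v))) :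
    ∃ (q : k[X]) (M : Matrix P P k[X]), q.eval t₀ ≠ 0 ∧ ∀ t, q.eval t ≠ 0 →
      r.DefinedAt (fun v => A v + t • (B v - A v)) ∧
      q.eval t • r.eval (fun v => A v + t • (B v - A v)) = M.map (Polynomial.eval t) := by
  induction r with
  | const c =>
    refine ⟨1, (1 : Matrix P P k).map (fun x => C (c * x)), by simp, fun t _ => ⟨trivial, ?_⟩⟩
    ext i j
    simp only [RatExpr.eval, Matrix.algebraMap_matrix_apply, Matrix.one_apply, Matrix.map_apply,
      Matrix.smul_apply, eval_one, one_smul]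
    split_ifs <;> simp
  | var v =>
    refine ⟨1, Matrix.of fun i j => C (A v i j) + X * C (B v i j - A v i j), by simp,
      fun t _ => ⟨trivial, ?_⟩⟩
    ext i j
    simp [RatExpr.eval]
  | add r s hr hs =>
    obtain ⟨q₁, M₁, h₁, H₁⟩ := hr h.1
    obtain ⟨q₂, M₂, h₂, H₂⟩ := hs h.2
    refine ⟨q₁ * q₂, q₂ • M₁ + q₁ • M₂, by simp [h₁, h₂], fun t ht => ?_⟩
    rw [eval_mul, mul_ne_zero_iff] at ht
    obtain ⟨d₁, e₁⟩ := H₁ t ht.1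
    obtain ⟨d₂, e₂⟩ := H₂ t ht.2
    refine ⟨⟨d₁, d₂⟩, ?_⟩
    ext i j
    have e₁' := congrFun (congrFun e₁ i) j
    have e₂' := congrFun (congrFun e₂ i) j
    simp only [Matrix.smul_apply, Matrix.map_apply, smul_eq_mul] at e₁' e₂'
    simp only [RatExpr.eval, Matrix.smul_apply, Matrix.map_apply, Matrix.add_apply, smul_eq_mul,
      eval_mul, eval_add, ← e₁', ← e₂']
    ring
  | mul r s hr hs =>
    obtain ⟨q₁, M₁, h₁, H₁⟩ := hr h.1
    obtain ⟨q₂, M₂, h₂, H₂⟩ := hs h.2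
    refine ⟨q₁ * q₂, M₁ * M₂, by simp [h₁, h₂], fun t ht => ?_⟩
    rw [eval_mul, mul_ne_zero_iff] at ht
    obtain ⟨d₁, e₁⟩ := H₁ t ht.1
    obtain ⟨d₂, e₂⟩ := H₂ t ht.2
    refine ⟨⟨d₁, d₂⟩, ?_⟩
    have := Matrix.map_mul (L := M₁) (M := M₂) (f := Polynomial.evalRingHom t)
    simp only [Polynomial.coe_evalRingHom] at this
    rw [this, ← e₁, ← e₂, RatExpr.eval, eval_mul, smul_mul_smul_comm]
  | inv r hr =>
    obtain ⟨q, M, h₁, H⟩ := hr h.1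
    have hdet : ∀ t, M.det.eval t = (M.map (Polynomial.eval t)).det := fun t => by
      have := RingHom.map_det (Polynomial.evalRingHom t) M
      simpa [RingHom.mapMatrix_apply] using this
    have hadj : ∀ t, M.adjugate.map (Polynomial.eval t) = (M.map (Polynomial.eval t)).adjugate :=
      fun t => by
      have := RingHom.map_adjugate (Polynomial.evalRingHom t) M
      simpa [RingHom.mapMatrix_apply] using this
    refine ⟨q * M.det, (q ^ 2) • M.adjugate, ?_, fun t ht => ?_⟩
    · rw [eval_mul]
      refine mul_ne_zero h₁ ?_
      rw [hdet, ← (H t₀ h₁).2, Matrix.det_smul]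
      exact mul_ne_zero (pow_ne_zero _ h₁) ((Matrix.isUnit_iff_isUnit_det _).1 h.2).ne_zero
    · rw [eval_mul, mul_ne_zero_iff] at ht
      obtain ⟨d, e⟩ := H t ht.1
      have hd := ht.2
      set E := r.eval (fun v => A v + t • (B v - A v)) with hE
      have hdet' : (M.map (Polynomial.eval t)).det ≠ 0 := by rw [← hdet]; exact hd
      have hEu : IsUnit E := by
        rw [Matrix.isUnit_iff_isUnit_det]
        rw [← e, Matrix.det_smul] at hdet'
        exact (right_ne_zero_of_mul hdet').isUnit
      refine ⟨⟨d, hEu⟩, ?_⟩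
      have hmap : ((q ^ 2) • M.adjugate).map (Polynomial.eval t) =
          (q.eval t) ^ 2 • (M.map (Polynomial.eval t)).adjugate := by
        rw [← hadj]; ext i j; simp
      rw [hmap, RatExpr.eval, ← hE, eval_mul]
      refine hEu.mul_left_cancel ?_
      have h2 : (M.map (Polynomial.eval t)) * (M.map (Polynomial.eval t)).adjugate =
          (M.map (Polynomial.eval t)).det • (1 : Matrix P P k) := Matrix.mul_adjugate _
      rw [mul_smul_comm, Ring.mul_inverse_cancel _ hEu, mul_smul_comm, pow_two, mul_smul,
        mul_smul, ← smul_mul_assoc (q.eval t) E, e, h2, hdet]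

theorem mp_line (π : V → ι) {n : ι → ℕ} (a b : MPPoint k π n) (t₀ : k)
    (r : RatExpr k V) (h : MPDefinedAt π r (a + t₀ • (b - a))) :
    ∃ (q : k[X]) (M : Matrix ((i : ι) → Fin (n i)) ((i : ι) → Fin (n i)) k[X]),
      q.eval t₀ ≠ 0 ∧ ∀ t, q.eval t ≠ 0 →
      MPDefinedAt π r (a + t • (b - a)) ∧
      q.eval t • mpEval π r (a + t • (b - a)) = M.map (Polynomial.eval t) := by
  have key : ∀ t : k, kronTuple π (a + t • (b - a)) =
      fun v => kronTuple π a v + t • (kronTuple π b v - kronTuple π a v) := fun t => by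
    funext v
    exact kronEmb_line _ _ _ _
  unfold MPDefinedAt mpEval at *
  simp only [key] at h ⊢
  exact RatExpr.line _ _ t₀ r h

end Line

section Equivalence

variable [CharZero k]

/-- Points of two levels can be moved to a common level. -/
theorem exists_common_level (π : V → ι) {n m : ι → ℕ} (hn : ∀ i, 0 < n i) (hm : ∀ i, 0 < m i)
    (a : MPPoint k π n) (b : MPPoint k π m) :
    ∃ (N : ι → ℕ) (φ : MPMatrix k n → MPMatrix k N) (a' b' : MPPoint k π N), (∀ i, 0 < N i) ∧
      Function.Injective φ ∧
      (∀ r : RatExpr k V, MPDefinedAt π r a → MPDefinedAt π r a' ∧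
        mpEval π r a' = φ (mpEval π r a)) ∧
      (∀ r : RatExpr k V, MPDefinedAt π r b → MPDefinedAt π r b') := by
  let ε : ∀ i, Fin (n i * m i) ≃ Fin (n i) × Fin (m i) := fun i => finProdFinEquiv.symm
  let δ : ∀ i, Fin (n i * m i) ≃ Fin (m i) × Fin (n i) := fun i =>
    (ε i).trans (Equiv.prodComm _ _)
  refine ⟨fun i => n i * m i, blowUp (piSplit ε), upPoint π ε a, upPoint π δ b,
    fun i => Nat.mul_pos (hn i) (hm i), blowUp_injective _ ⟨fun i => ⟨0, hm i⟩⟩,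
    fun r hr => mp_up π ε r a hr, fun r hr => (mp_up π δ r b hr).1⟩

theorem MPNondegenerate.common (π : V → ι) {r s : RatExpr k V} (hr : MPNondegenerate π r)
    (hs : MPNondegenerate π s) : ∃ n : ι → ℕ, (∀ i, 0 < n i) ∧ ∃ a : MPPoint k π n,
      MPDefinedAt π r a ∧ MPDefinedAt π s a := by
  obtain ⟨n, hn, a, ha⟩ := hr
  obtain ⟨m, hm, b, hb⟩ := hs
  obtain ⟨N, φ, a', b', hN, -, h1, h2⟩ := exists_common_level π hn hm a b
  have ha' := (h1 r ha).1
  have hb' := h2 s hb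
  obtain ⟨q₁, _, z₁, H₁⟩ := mp_line π a' b' 0 r (by simpa using ha')
  obtain ⟨q₂, _, z₂, H₂⟩ := mp_line π a' b' 1 s (by simpa using hb')
  have hne : q₁ * q₂ ≠ 0 := mul_ne_zero (by rintro rfl; simp at z₁) (by rintro rfl; simp at z₂)
  obtain ⟨t, ht⟩ : ∃ t, (q₁ * q₂).eval t ≠ 0 := by
    by_contra! hc
    exact hne (Polynomial.funext (by simpa using hc))
  rw [Polynomial.eval_mul, mul_ne_zero_iff] at ht
  exact ⟨N, hN, _, (H₁ t ht.1).1, (H₂ t ht.2).1⟩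

theorem MPEquiv.trans_of_nondegenerate (π : V → ι) {r s u : RatExpr k V}
    (hs : MPNondegenerate π s) (h₁ : MPEquiv π r s) (h₂ : MPEquiv π s u) : MPEquiv π r u := by
  intro n hn a har hau
  obtain ⟨m, hm, b, hb⟩ := hs
  obtain ⟨N, φ, a', b', hN, hφ, H1, H2⟩ := exists_common_level π hn hm a b
  apply hφ
  rw [← (H1 r har).2, ← (H1 u hau).2]
  obtain ⟨q₁, M₁, z₁, K₁⟩ := mp_line π a' b' 0 r (by simpa using (H1 r har).1)
  obtain ⟨q₂, _, z₂, K₂⟩ := mp_line π a' b' 1 s (by simpa using (H2 s hb))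
  obtain ⟨q₃, M₃, z₃, K₃⟩ := mp_line π a' b' 0 u (by simpa using (H1 u hau).1)
  have hne : q₁ * q₂ * q₃ ≠ 0 := mul_ne_zero (mul_ne_zero (by rintro rfl; simp at z₁)
    (by rintro rfl; simp at z₂)) (by rintro rfl; simp at z₃)
  ext x y
  have hpoly : q₁ * q₂ * q₃ * (q₃ * M₁ x y - q₁ * M₃ x y) = 0 := by
    refine Polynomial.funext fun t => ?_
    rw [Polynomial.eval_mul, Polynomial.eval_zero]
    by_cases ht : (q₁ * q₂ * q₃).eval t = 0
    · rw [ht, zero_mul]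
    · simp only [Polynomial.eval_mul, mul_eq_zero, not_or] at ht
      obtain ⟨⟨t₁, t₂⟩, t₃⟩ := ht
      obtain ⟨d₁, e₁⟩ := K₁ t t₁
      obtain ⟨d₂, -⟩ := K₂ t t₂
      obtain ⟨d₃, e₃⟩ := K₃ t t₃
      have heq := (h₁ N hN _ d₁ d₂).trans (h₂ N hN _ d₂ d₃)
      have e₁' := congrFun (congrFun e₁ x) y
      have e₃' := congrFun (congrFun e₃ x) y
      simp only [Matrix.smul_apply, Matrix.map_apply, smul_eq_mul] at e₁' e₃'
      simp only [Polynomial.eval_mul, Polynomial.eval_sub, ← e₁', ← e₃', heq]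
      ring
  have hz := (mul_eq_zero.1 hpoly).resolve_left hne
  have hz0 := congrArg (Polynomial.eval 0) hz
  have e₁ := congrFun (congrFun (K₁ 0 z₁).2 x) y
  have e₃ := congrFun (congrFun (K₃ 0 z₃).2 x) y
  simp only [Matrix.smul_apply, Matrix.map_apply, smul_eq_mul, zero_smul, add_zero] at e₁ e₃
  simp only [Polynomial.eval_mul, Polynomial.eval_sub, Polynomial.eval_zero, ← e₁, ← e₃] at hz0
  have hfac : q₁.eval 0 * q₃.eval 0 * (mpEval π r a' x y - mpEval π u a' x y) = 0 := by
    linear_combination hz0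
  exact sub_eq_zero.1 ((mul_eq_zero.1 hfac).resolve_left (mul_ne_zero z₁ z₃))

/-- Equality of mp-evaluations, as an equivalence relation on mp-nondegenerate expressions. -/
def mpSetoid (k : Type*) [Field k] [CharZero k] (π : V → ι) :
    Setoid {r : RatExpr k V // MPNondegenerate π r} where
  r r s := MPEquiv π r.1 s.1
  iseqv :=
    { refl := fun _ _ _ _ _ _ => rfl
      symm := fun h n hn a h1 h2 => (h n hn a h2 h1).symm
      trans := fun {_ s _} h₁ h₂ => MPEquiv.trans_of_nondegenerate π s.2 h₁ h₂ }

/-- Multipartite rational functions over `k` in the variables `V`, partitioned by `π : V → ι`. -/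
def MPRat (k : Type*) [Field k] [CharZero k] (π : V → ι) : Type _ := Quotient (mpSetoid k π)

/-- The mp rational function represented by an mp-nondegenerate expression. -/
def MPRat.mk (π : V → ι) (r : RatExpr k V) (hr : MPNondegenerate π r) : MPRat k π :=
  Quotient.mk (mpSetoid k π) ⟨r, hr⟩

theorem MPNondegenerate.const (π : V → ι) (c : k) : MPNondegenerate π (RatExpr.const c) :=
  ⟨fun _ => 1, fun _ => one_pos, fun _ => 0, trivial⟩

theorem MPNondegenerate.add (π : V → ι) {r s : RatExpr k V} (hr : MPNondegenerate π r)
    (hs : MPNondegenerate π s) : MPNondegenerate π (RatExpr.add r s) := hr.common π hs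

theorem MPNondegenerate.mul (π : V → ι) {r s : RatExpr k V} (hr : MPNondegenerate π r)
    (hs : MPNondegenerate π s) : MPNondegenerate π (RatExpr.mul r s) := hr.common π hs

theorem MPNondegenerate.neg (π : V → ι) {r : RatExpr k V} (hr : MPNondegenerate π r) :
    MPNondegenerate π (RatExpr.neg r) := (MPNondegenerate.const π _).mul π hr

namespace MPRat

variable {π : V → ι}

theorem mk_eq_mk {r s : RatExpr k V} {hr : MPNondegenerate π r} {hs : MPNondegenerate π s} :
    mk π r hr = mk π s hs ↔ MPEquiv π r s := Quotient.eq (r := mpSetoid k π)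

theorem exists_rep (x : MPRat k π) : ∃ r hr, mk π r hr = x :=
  Quotient.inductionOn x fun r => ⟨r.1, r.2, rfl⟩

instance : Add (MPRat k π) where
  add := Quotient.map₂ (fun r s => ⟨RatExpr.add r.1 s.1, r.2.add π s.2⟩) (by
    intro r r' h s s' h' n hn a h1 h2
    change _ + _ = _ + _
    exact congrArg₂ _ (h n hn a h1.1 h2.1) (h' n hn a h1.2 h2.2))

instance : Mul (MPRat k π) where
  mul := Quotient.map₂ (fun r s => ⟨RatExpr.mul r.1 s.1, r.2.mul π s.2⟩) (by
    intro r r' h s s' h' n hn a h1 h2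
    change _ * _ = _ * _
    exact congrArg₂ _ (h n hn a h1.1 h2.1) (h' n hn a h1.2 h2.2))

instance : Neg (MPRat k π) where
  neg := Quotient.map (fun r => ⟨RatExpr.neg r.1, r.2.neg π⟩) (by
    intro r r' h n hn a h1 h2
    change _ * _ = _ * _
    exact congrArg₂ _ rfl (h n hn a h1.2 h2.2))

instance : Zero (MPRat k π) where
  zero := mk π (RatExpr.const 0) (MPNondegenerate.const π 0)

instance : One (MPRat k π) where
  one := mk π (RatExpr.const 1) (MPNondegenerate.const π 1)

theorem mk_add (r s : RatExpr k V) (hr : MPNondegenerate π r) (hs : MPNondegenerate π s) :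
    mk π r hr + mk π s hs = mk π (RatExpr.add r s) (hr.add π hs) := rfl

theorem mk_mul (r s : RatExpr k V) (hr : MPNondegenerate π r) (hs : MPNondegenerate π s) :
    mk π r hr * mk π s hs = mk π (RatExpr.mul r s) (hr.mul π hs) := rfl

theorem mk_neg (r : RatExpr k V) (hr : MPNondegenerate π r) :
    -mk π r hr = mk π (RatExpr.neg r) (hr.neg π) := rfl

theorem zero_def : (0 : MPRat k π) = mk π (RatExpr.const 0) (MPNondegenerate.const π 0) := rfl

theorem one_def : (1 : MPRat k π) = mk π (RatExpr.const 1) (MPNondegenerate.const π 1) := rfl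

theorem mk_eq_of_eval {r s : RatExpr k V} {hr : MPNondegenerate π r} {hs : MPNondegenerate π s}
    (h : ∀ (n : ι → ℕ) (a : V → MPMatrix k n), r.eval a = s.eval a) :
    mk π r hr = mk π s hs :=
  mk_eq_mk.2 fun n _ a _ _ => h n (kronTuple π a)

/-- The ring structure: operations are the operations on expressions. -/
instance : Ring (MPRat k π) where
  add_assoc x y z := by
    obtain ⟨r, hr, rfl⟩ := exists_rep x
    obtain ⟨s, hs, rfl⟩ := exists_rep y
    obtain ⟨u, hu, rfl⟩ := exists_rep z
    exact mk_eq_of_eval fun n a => add_assoc _ _ _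
  zero_add x := by
    obtain ⟨r, hr, rfl⟩ := exists_rep x
    exact mk_eq_of_eval fun n a => by simp [RatExpr.eval]
  add_zero x := by
    obtain ⟨r, hr, rfl⟩ := exists_rep x
    exact mk_eq_of_eval fun n a => by simp [RatExpr.eval]
  add_comm x y := by
    obtain ⟨r, hr, rfl⟩ := exists_rep x
    obtain ⟨s, hs, rfl⟩ := exists_rep y
    exact mk_eq_of_eval fun n a => add_comm _ _
  neg_add_cancel x := by
    obtain ⟨r, hr, rfl⟩ := exists_rep x
    exact mk_eq_of_eval fun n a => by simp [RatExpr.eval, RatExpr.neg]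
  left_distrib x y z := by
    obtain ⟨r, hr, rfl⟩ := exists_rep x
    obtain ⟨s, hs, rfl⟩ := exists_rep y
    obtain ⟨u, hu, rfl⟩ := exists_rep z
    exact mk_eq_of_eval fun n a => mul_add _ _ _
  right_distrib x y z := by
    obtain ⟨r, hr, rfl⟩ := exists_rep x
    obtain ⟨s, hs, rfl⟩ := exists_rep y
    obtain ⟨u, hu, rfl⟩ := exists_rep z
    exact mk_eq_of_eval fun n a => add_mul _ _ _
  zero_mul x := by
    obtain ⟨r, hr, rfl⟩ := exists_rep x
    exact mk_eq_of_eval fun n a => by simp [RatExpr.eval]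
  mul_zero x := by
    obtain ⟨r, hr, rfl⟩ := exists_rep x
    exact mk_eq_of_eval fun n a => by simp [RatExpr.eval]
  mul_assoc x y z := by
    obtain ⟨r, hr, rfl⟩ := exists_rep x
    obtain ⟨s, hs, rfl⟩ := exists_rep y
    obtain ⟨u, hu, rfl⟩ := exists_rep z
    exact mk_eq_of_eval fun n a => mul_assoc _ _ _
  one_mul x := by
    obtain ⟨r, hr, rfl⟩ := exists_rep x
    exact mk_eq_of_eval fun n a => by simp [RatExpr.eval]
  mul_one x := by
    obtain ⟨r, hr, rfl⟩ := exists_rep x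
    exact mk_eq_of_eval fun n a => by simp [RatExpr.eval]
  nsmul := nsmulRec
  zsmul := zsmulRec

/-- The `k`-algebra structure: scalars are the constant expressions. -/
instance : Algebra k (MPRat k π) where
  algebraMap :=
    { toFun := fun c => mk π (RatExpr.const c) (MPNondegenerate.const π c)
      map_one' := rfl
      map_zero' := rfl
      map_add' := fun c d => mk_eq_of_eval fun n a => by simp [RatExpr.eval]
      map_mul' := fun c d => mk_eq_of_eval fun n a => by simp [RatExpr.eval] }
  smul c x := mk π (RatExpr.const c) (MPNondegenerate.const π c) * x
  commutes' c x := by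
    obtain ⟨r, hr, rfl⟩ := exists_rep x
    exact mk_eq_of_eval fun n a => Algebra.commutes _ _
  smul_def' _ _ := rfl

end MPRat

section Rename

/-- Decomposition of multi-indices along an injection of the index sets of the parts. -/
def embSplit (e : ι ↪ κ) (m : κ → ℕ) :
    ((c : κ) → Fin (m c)) ≃
      ((i : ι) → Fin (m (e i))) × ((c : {c : κ // c ∉ Set.range e}) → Fin (m c)) :=
  Equiv.ofBijective (fun p => (fun i => p (e i), fun c => p c)) (by
    classical
    constructor
    · intro p q h
      funext c
      by_cases hc : c ∈ Set.range e
      · obtain ⟨i, rfl⟩ := hc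
        exact congrFun (congrArg Prod.fst h) i
      · exact congrFun (congrArg Prod.snd h) ⟨c, hc⟩
    · rintro ⟨p, q⟩
      have hinv : ∀ c (h : c ∈ Set.range e), e h.choose = c := fun c h => h.choose_spec
      refine ⟨fun c => if h : c ∈ Set.range e then Fin.cast (by rw [hinv c h]) (p h.choose)
        else q ⟨c, h⟩, ?_⟩
      refine Prod.ext ?_ ?_
      · funext i
        have hi : e i ∈ Set.range e := ⟨i, rfl⟩
        have aux : ∀ i', i' = i → ∀ hh : m (e i') = m (e i), Fin.cast hh (p i') = p i := by
          rintro i' rfl hh; rfl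
        simp only [dif_pos hi]
        exact aux _ (e.injective (hinv _ hi)) _
      · funext c
        simp only [dif_neg c.2])

theorem embSplit_apply (e : ι ↪ κ) (m : κ → ℕ) (p : (c : κ) → Fin (m c)) :
    embSplit e m p =
      (fun i => p (e i), fun c : {c : κ // c ∉ Set.range e} => p c) := rfl

/-- The restriction of a tuple along a map of variables. -/
def pullPoint {π : V → ι} {ρ : W → κ} (f : V → W) (e : ι ↪ κ) (hf : ∀ v, ρ (f v) = e (π v))
    {m : κ → ℕ} (b : MPPoint k ρ m) : MPPoint k π (m ∘ e) :=
  fun v => (b (f v)).submatrix (Fin.cast (congrArg m (hf v).symm))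
    (Fin.cast (congrArg m (hf v).symm))

theorem kronTuple_pullPoint {π : V → ι} {ρ : W → κ} (f : V → W) (e : ι ↪ κ)
    (hf : ∀ v, ρ (f v) = e (π v)) {m : κ → ℕ} (b : MPPoint k ρ m) :
    kronTuple ρ b ∘ f =
      blowUp (P := (i : ι) → Fin (m (e i))) (embSplit e m) ∘
        kronTuple π (pullPoint f e hf b) := by
  classical
  funext v
  have key : ∀ (x : κ) (hx : x = e (π v)) (y : Matrix (Fin (m x)) (Fin (m x)) k),
      kronEmb x y = blowUp (P := (i : ι) → Fin (m (e i))) (embSplit e m)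
        (kronEmb (n := m ∘ e) (π v) (y.submatrix (Fin.cast (congrArg m hx.symm))
          (Fin.cast (congrArg m hx.symm)))) := by
    rintro x rfl y
    ext p q
    rw [blowUp_apply, kronEmb_apply, kronEmb_apply, ← ite_and]
    refine if_congr ?_ rfl rfl
    simp only [embSplit_apply]
    constructor
    · intro h
      refine ⟨funext fun c => h _ fun hc => c.2 ⟨_, hc.symm⟩, fun j hj => h _ fun hc => hj ?_⟩
      exact e.injective hc
    · rintro ⟨h1, h2⟩ c hc
      by_cases hr : c ∈ Set.range e
      · obtain ⟨i, rfl⟩ := hr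
        exact h2 i fun h => hc (by rw [h])
      · exact congrFun h1 ⟨c, hr⟩
  exact key _ (hf v) _

theorem mp_rename {π : V → ι} {ρ : W → κ} (f : V → W) (e : ι ↪ κ)
    (hf : ∀ v, ρ (f v) = e (π v)) {m : κ → ℕ} (hm : ∀ c, 0 < m c) (b : MPPoint k ρ m)
    (r : RatExpr k V) :
    (MPDefinedAt ρ (r.rename f) b ↔ MPDefinedAt π r (pullPoint f e hf b)) ∧
      (MPDefinedAt π r (pullPoint f e hf b) →
        mpEval ρ (r.rename f) b = blowUp (P := (i : ι) → Fin (m (e i))) (embSplit e m)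
          (mpEval π r (pullPoint f e hf b))) := by
  unfold MPDefinedAt mpEval
  rw [RatExpr.definedAt_rename, RatExpr.eval_rename, kronTuple_pullPoint f e hf b]
  refine ⟨⟨fun h => RatExpr.definedAt_of_map _ (isUnit_of_blowUp _ ⟨fun c => ⟨0, hm _⟩⟩) _ _ h,
    fun h => (RatExpr.map_eval _ _ _ h).1⟩, fun h => (RatExpr.map_eval _ _ _ h).2⟩

theorem MPNondegenerate.rename {π : V → ι} {ρ : W → κ} (f : V → W) (hfi : Function.Injective f)
    (e : ι ↪ κ) (hf : ∀ v, ρ (f v) = e (π v)) {r : RatExpr k V} (hr : MPNondegenerate π r) :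
    MPNondegenerate ρ (r.rename f) := by
  classical
  obtain ⟨n, hn, a, ha⟩ := hr
  let m : κ → ℕ := fun c => if h : ∃ i, e i = c then n h.choose else 1
  have hme : m ∘ e = n := by
    funext i
    have h : ∃ i', e i' = e i := ⟨i, rfl⟩
    simp only [m, Function.comp_apply, dif_pos h]
    exact congrArg n (e.injective h.choose_spec)
  have hm : ∀ c, 0 < m c := fun c => by
    simp only [m]; split_ifs
    · exact hn _
    · exact one_pos
  clear_value m
  subst hme
  have hmv : ∀ v, m (e (π v)) = m (ρ (f v)) := fun v => by rw [hf]
  let b : MPPoint k ρ m := fun w => if h : ∃ v, f v = w then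
    Matrix.of fun x y => a h.choose (Fin.cast (by rw [Function.comp_apply, hmv, h.choose_spec]) x)
      (Fin.cast (by rw [Function.comp_apply, hmv, h.choose_spec]) y) else 0
  refine ⟨m, hm, b, ((mp_rename f e hf hm b r).1).2 ?_⟩
  convert ha
  funext v
  ext s t
  have h : ∃ v', f v' = f v := ⟨v, rfl⟩
  simp only [pullPoint, b, dif_pos h, Matrix.of_apply, Matrix.submatrix_apply]
  have aux2 : ∀ v' (_ : v' = v) (h₁ h₂ : (m ∘ e) (π v) = (m ∘ e) (π v')),
      a v' (Fin.cast h₁ s) (Fin.cast h₂ t) = a v s t := by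
    rintro v' rfl _ _; rfl
  have hv := hfi h.choose_spec
  exact aux2 _ hv (by rw [hv]) (by rw [hv])

theorem MPEquiv.rename {π : V → ι} {ρ : W → κ} (f : V → W)
    (e : ι ↪ κ) (hf : ∀ v, ρ (f v) = e (π v)) {r s : RatExpr k V} (h : MPEquiv π r s) :
    MPEquiv ρ (r.rename f) (s.rename f) := by
  intro m hm b hr hs
  obtain ⟨d1, e1⟩ := mp_rename f e hf hm b r
  obtain ⟨d2, e2⟩ := mp_rename f e hf hm b s
  rw [e1 (d1.1 hr), e2 (d2.1 hs), h (m ∘ e) (fun i => hm _) _ (d1.1 hr) (d2.1 hs)]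

/-- The homomorphism of algebras of mp rational functions that substitutes the variables of the
`i`-th part by distinct variables of the `e i`-th part. -/
def MPRat.rename {π : V → ι} {ρ : W → κ} (f : V → W) (hfi : Function.Injective f)
    (e : ι ↪ κ) (hf : ∀ v, ρ (f v) = e (π v)) : MPRat k π →ₐ[k] MPRat k ρ where
  toFun := Quotient.map (fun r => ⟨r.1.rename f, r.2.rename f hfi e hf⟩)
    (fun _ _ h => MPEquiv.rename f e hf h)
  map_one' := rfl
  map_zero' := rfl
  map_mul' x y := by
    obtain ⟨r, hr, rfl⟩ := MPRat.exists_rep x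
    obtain ⟨s, hs, rfl⟩ := MPRat.exists_rep y
    rfl
  map_add' x y := by
    obtain ⟨r, hr, rfl⟩ := MPRat.exists_rep x
    obtain ⟨s, hs, rfl⟩ := MPRat.exists_rep y
    rfl
  commutes' _ := rfl

theorem MPRat.rename_mk {π : V → ι} {ρ : W → κ} (f : V → W) (hfi : Function.Injective f)
    (e : ι ↪ κ) (hf : ∀ v, ρ (f v) = e (π v)) (r : RatExpr k V) (hr : MPNondegenerate π r) :
    MPRat.rename f hfi e hf (MPRat.mk π r hr) =
      MPRat.mk ρ (r.rename f) (hr.rename f hfi e hf) := rfl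

end Rename

end Equivalence

end Multipartite

/-! ### Difference-differential operators -/

section Delta

variable {G : ℕ}

/-- The variables `X = X^(1) ∪ ⋯ ∪ X^(G)`, where the `i`-th part has `g i` variables. -/
abbrev MPVar (g : Fin G → ℕ) : Type := (i : Fin G) × Fin (g i)

/-- The partition of `X` into its `G` parts. -/
abbrev mpPart (g : Fin G → ℕ) : MPVar g → Fin G := Sigma.fst

/-- The variables `X'^(i) ∪ X`, where `X'^(i)` is a copy of `X^(i)`. -/
abbrev MPVarExt (g : Fin G → ℕ) (i : Fin G) : Type := Fin (g i) ⊕ MPVar g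

/-- The partition of `X'^(i) ∪ X` into the `G + 1` parts
`X^(1), …, X^(i-1), X'^(i), X^(i), …, X^(G)`, in this order. -/
def mpPartExt (g : Fin G → ℕ) (i : Fin G) : MPVarExt g i → Fin (G + 1)
  | Sum.inl _ => i.castSucc
  | Sum.inr v => i.castSucc.succAbove v.1

/-- The substitution that replaces `X^(i)` by `X'^(i)` and fixes the other variables. -/
def primeVar (g : Fin G → ℕ) (i : Fin G) (v : MPVar g) : MPVarExt g i :=
  if h : v.1 = i then Sum.inl (Fin.cast (congrArg g h) v.2) else Sum.inr v

/-- The partial difference-differential operator on expressions, for the `j`-th variable of the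
`i`-th part. -/
def delta {k : Type*} [Field k] {g : Fin G → ℕ} (i : Fin G) (j : Fin (g i)) :
    RatExpr k (MPVar g) → RatExpr k (MPVarExt g i)
  | .const _ => .const 0
  | .var v => .const (if v = ⟨i, j⟩ then 1 else 0)
  | .add r s => .add (delta i j r) (delta i j s)
  | .mul r s => .add (.mul (r.rename (primeVar g i)) (delta i j s))
      (.mul (delta i j r) (s.rename Sum.inr))
  | .inv r => .neg (.mul (.mul (.inv (r.rename (primeVar g i))) (delta i j r))
      (.inv (r.rename Sum.inr)))

/-- The parts visited by `primeVar`. -/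
def primePart (i : Fin G) : Fin G ↪ Fin (G + 1) where
  toFun l := if l = i then i.castSucc else i.castSucc.succAbove l
  inj' := by
    intro l l' h
    dsimp only at h
    split_ifs at h with h1 h2 h2
    · rw [h1, h2]
    · exact absurd h.symm (Fin.succAbove_ne _ _)
    · exact absurd h (Fin.succAbove_ne _ _)
    · exact Fin.succAbove_right_injective h

theorem mpPartExt_primeVar (g : Fin G → ℕ) (i : Fin G) (v : MPVar g) :
    mpPartExt g i (primeVar g i v) = primePart i (mpPart g v) := by
  unfold primeVar primePart mpPart
  by_cases h : v.1 = i
  · rw [dif_pos h]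
    exact (if_pos h).symm
  · rw [dif_neg h]
    exact (if_neg h).symm

theorem primeVar_injective (g : Fin G → ℕ) (i : Fin G) : Function.Injective (primeVar g i) := by
  rintro ⟨l, x⟩ ⟨l', x'⟩ h
  unfold primeVar at h
  split_ifs at h with h1 h2 h2
  · dsimp only at h1 h2
    subst h1
    subst h2
    simpa using h
  · exact Sum.inr_injective h

variable (k : Type*) [Field k] [CharZero k] (g : Fin G → ℕ) (i : Fin G)

/-- The `k`-algebra of mp rational functions in `X^(1), …, X^(G)`. -/
abbrev MPRatX : Type _ := MPRat k (mpPart g)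

/-- The embedding `𝕣 ↦ 𝕣(…, X'^(i), …)`. -/
def mpPrime : MPRatX k g →ₐ[k] MPRat k (mpPartExt g i) :=
  MPRat.rename (primeVar g i) (primeVar_injective g i) (primePart i) (mpPartExt_primeVar g i)

/-- The embedding `𝕣 ↦ 𝕣(…, X^(i), …)`. -/
def mpIncl : MPRatX k g →ₐ[k] MPRat k (mpPartExt g i) :=
  MPRat.rename Sum.inr Sum.inr_injective (Fin.succAboveEmb i.castSucc) (fun _ => rfl)

/-- The mp rational functions in `X^(1), …, X'^(i), X^(i), …, X^(G)`, regarded below as a bimodule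
over the mp rational functions in `X^(1), …, X^(G)`. -/
def MPRatExt : Type _ := MPRat k (mpPartExt g i)

instance : Ring (MPRatExt k g i) := inferInstanceAs (Ring (MPRat k (mpPartExt g i)))

instance : Algebra k (MPRatExt k g i) := inferInstanceAs (Algebra k (MPRat k (mpPartExt g i)))

/-- The mp rational function in `X^(1), …, X'^(i), X^(i), …, X^(G)` represented by an expression. -/
def MPRatExt.mk (r : RatExpr k (MPVarExt g i)) (hr : MPNondegenerate (mpPartExt g i) r) :
    MPRatExt k g i := MPRat.mk (mpPartExt g i) r hr

/-- The left action `𝕣 • 𝕤 = 𝕣(…, X'^(i), …) 𝕤`. -/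
instance : Module (MPRatX k g) (MPRatExt k g i) :=
  Module.compHom (MPRat k (mpPartExt g i)) (mpPrime k g i).toRingHom

/-- The right action `𝕤 <• 𝕣 = 𝕤 𝕣(…, X^(i), …)`. -/
instance : Module (MPRatX k g)ᵐᵒᵖ (MPRatExt k g i) :=
  Module.compHom (MPRat k (mpPartExt g i))
    (RingHom.op (mpIncl k g i).toRingHom)

theorem MPRatExt.left_smul_def (r : MPRatX k g) (s : MPRatExt k g i) :
    r • s = (show MPRatExt k g i from mpPrime k g i r) * s := rfl

theorem MPRatExt.right_smul_def (r : MPRatX k g) (s : MPRatExt k g i) :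
    s <• r = s * (show MPRatExt k g i from mpIncl k g i r) := rfl

instance : SMulCommClass (MPRatX k g) (MPRatX k g)ᵐᵒᵖ (MPRatExt k g i) where
  smul_comm r s t := by
    obtain ⟨s, rfl⟩ := MulOpposite.op_surjective s
    exact (mul_assoc _ _ _).symm

end Delta

end

/-!
The operator `delta i j` is an off-diagonal block. Take a tuple `b` in the variables `X'^(i) ∪ X`,
let `a'` and `a` be its restrictions along the two copies of `X`, and evaluate `r` at the tuple in
which each matrix `x` of the `i`-th part is replaced by a block upper triangular matrix with
diagonal blocks `a' x` and `a x`; the off-diagonal block is an elementary matrix `E_{pq}` for the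
`j`-th variable and zero for all other variables (`exists_block_point`). The multiplication and
inversion rules for such matrices are the recursive rules that define `delta`. Hence the value of
`r` has diagonal blocks `r(a')` and `r(a)`, and its off-diagonal block is obtained from the value of
`delta i j r` at `b` by the substitution `A ⊗ B ↦ A E_{pq} B` (`compress`, `eval_fromBlocks`).

All the inversions in `r` occur in `delta i j r` for both copies of the variables, so `delta i j r`
is defined at `b` exactly when `r` is defined at `a'` and at `a` (`definedAt_delta_iff`). This gives
nondegeneracy. If moreover `r` and `s` are equivalent, their values at the block tuples agree, so
the values of `delta i j r` and `delta i j s` agree after compression with every `E_{pq}`; these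
compressions contain all matrix entries (`eq_of_compress_eq`), so the values themselves agree
(`MPEquiv.delta`). The Leibniz rule then holds already for expressions.
-/

noncomputable section

/-! ### Evaluation at block upper triangular matrices -/

section BlockTriangular

open Matrix

variable {k : Type*} [Field k]

section Compression

variable {P P' K Q Q' : Type}

/-- The block of `M` with row index `q` in the second component of `e'` and column index `p` in the
second component of `e`. For `M = A ⊗ B` with `A` of size `n'` and `B` of size `n`, it is
`A E_{pq} B`. -/
def compress (e' : K ≃ P' × Q') (e : K ≃ P × Q) (q : Q') (p : Q) :
    Matrix K K k →ₗ[k] Matrix P' P k where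
  toFun M := M.submatrix (fun u => e'.symm (u, q)) (fun v => e.symm (v, p))
  map_add' _ _ := rfl
  map_smul' _ _ := rfl

theorem compress_apply (e' : K ≃ P' × Q') (e : K ≃ P × Q) (q : Q') (p : Q) (M : Matrix K K k)
    (u : P') (v : P) : compress e' e q p M u v = M (e'.symm (u, q)) (e.symm (v, p)) := rfl

/-- Compression turns the two actions `A ⊗ I` and `I ⊗ B` into left and right multiplication. -/
theorem compress_blowUp_mul [Fintype P'] [DecidableEq P'] [Fintype K] [DecidableEq K] [Fintype Q']
    [DecidableEq Q'] (e' : K ≃ P' × Q') (e : K ≃ P × Q) (q : Q') (p : Q)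
    (A : Matrix P' P' k) (M : Matrix K K k) :
    compress e' e q p (blowUp e' A * M) = A * compress e' e q p M := by
  ext u v
  simp only [compress_apply, Matrix.mul_apply, blowUp_apply, Equiv.apply_symm_apply]
  rw [← e'.symm.sum_comp, Fintype.sum_prod_type]
  simp

theorem compress_mul_blowUp [Fintype P] [DecidableEq P] [Fintype K] [DecidableEq K] [Fintype Q]
    [DecidableEq Q] (e' : K ≃ P' × Q') (e : K ≃ P × Q) (q : Q') (p : Q)
    (M : Matrix K K k) (B : Matrix P P k) :
    compress e' e q p (M * blowUp e B) = compress e' e q p M * B := by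
  ext u v
  simp only [compress_apply, Matrix.mul_apply, blowUp_apply, Equiv.apply_symm_apply]
  rw [← e.symm.sum_comp, Fintype.sum_prod_type]
  simp

/-- The compressions of a matrix jointly contain all of its entries. -/
theorem eq_of_compress_eq (e' : K ≃ P' × Q') (e : K ≃ P × Q) {M N : Matrix K K k}
    (h : ∀ q p, compress e' e q p M = compress e' e q p N) : M = N := by
  ext x y
  simpa [compress_apply] using congrFun₂ (h (e' x).2 (e y).2) (e' x).1 (e y).1

end Compression

theorem isUnit_fromBlocks_upper {P P' : Type} [Fintype P] [DecidableEq P] [Fintype P']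
    [DecidableEq P'] {A : Matrix P' P' k} {D : Matrix P P k} (B : Matrix P' P k)
    (hA : IsUnit A) (hD : IsUnit D) : IsUnit (fromBlocks A B 0 D) ∧
      Ring.inverse (fromBlocks A B 0 D) =
        fromBlocks (Ring.inverse A) (-(Ring.inverse A * B * Ring.inverse D)) 0
          (Ring.inverse D) := by
  have h := Matrix.isUnit_fromBlocks_zero₂₁ (B := B) |>.2 ⟨hA, hD⟩
  refine ⟨h, ?_⟩
  simp only [← Matrix.nonsing_inv_eq_ringInverse]
  exact Matrix.inv_fromBlocks_zero₂₁_of_isUnit_iff _ _ _ ⟨fun _ => hD, fun _ => hA⟩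

variable {G : ℕ} {g : Fin G → ℕ}

/-- Every inversion in `r` survives in `delta i j r`, once for each of the two copies of `r`. -/
theorem definedAt_delta_iff {A : Type*} [Ring A] [Algebra k A] (i : Fin G) (j : Fin (g i))
    (b : MPVarExt g i → A) (r : RatExpr k (MPVar g)) :
    (delta i j r).DefinedAt b ↔
      (r.rename (primeVar g i)).DefinedAt b ∧ (r.rename Sum.inr).DefinedAt b := by
  induction r with
  | const c => simp [delta, RatExpr.rename, RatExpr.DefinedAt]
  | var v => simp [delta, RatExpr.rename, RatExpr.DefinedAt]
  | add r s hr hs => simp only [delta, RatExpr.rename, RatExpr.DefinedAt, hr, hs]; tauto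
  | mul r s hr hs => simp only [delta, RatExpr.rename, RatExpr.DefinedAt, hr, hs]; tauto
  | inv r hr =>
    simp only [delta, RatExpr.neg, RatExpr.rename, RatExpr.DefinedAt, hr]; tauto

/-- Evaluation at block upper triangular matrices computes `delta`: the diagonal blocks of the value
are the values at the diagonal blocks, and the off-diagonal block is a compression of the value
of `delta i j r`. -/
theorem eval_fromBlocks {P P' K Q Q' : Type} [Fintype P] [DecidableEq P] [Fintype P']
    [DecidableEq P'] [Fintype K] [DecidableEq K] [Fintype Q] [DecidableEq Q] [Fintype Q']
    [DecidableEq Q'] (e' : K ≃ P' × Q') (e : K ≃ P × Q) (q : Q') (p : Q)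
    (i : Fin G) (j : Fin (g i)) (b : MPVarExt g i → Matrix K K k)
    (a' : MPVar g → Matrix P' P' k) (a : MPVar g → Matrix P P k)
    (ha' : b ∘ primeVar g i = blowUp e' ∘ a') (ha : b ∘ Sum.inr = blowUp e ∘ a)
    (r : RatExpr k (MPVar g)) (hr' : r.DefinedAt a') (hr : r.DefinedAt a) :
    r.DefinedAt (fun v => fromBlocks (a' v)
        ((if v = ⟨i, j⟩ then (1 : k) else 0) • compress e' e q p 1) 0 (a v)) ∧
      r.eval (fun v => fromBlocks (a' v)
        ((if v = ⟨i, j⟩ then (1 : k) else 0) • compress e' e q p 1) 0 (a v)) =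
        fromBlocks (r.eval a') (compress e' e q p ((delta i j r).eval b)) 0 (r.eval a) := by
  have H' : ∀ s : RatExpr k (MPVar g), s.DefinedAt a' →
      (s.rename (primeVar g i)).eval b = blowUp e' (s.eval a') := fun s hs => by
    rw [RatExpr.eval_rename, ha', (RatExpr.map_eval _ _ _ hs).2]
  have H : ∀ s : RatExpr k (MPVar g), s.DefinedAt a →
      (s.rename Sum.inr).eval b = blowUp e (s.eval a) := fun s hs => by
    rw [RatExpr.eval_rename, ha, (RatExpr.map_eval _ _ _ hs).2]
  induction r with
  | const c =>
    refine ⟨trivial, ?_⟩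
    simp only [RatExpr.eval, delta, map_zero, Algebra.algebraMap_eq_smul_one]
    rw [← fromBlocks_one, fromBlocks_smul, smul_zero, smul_zero]
  | var v =>
    refine ⟨trivial, ?_⟩
    simp only [RatExpr.eval, delta, Algebra.algebraMap_eq_smul_one, map_smul]
  | add r s ihr ihs =>
    obtain ⟨d₁, e₁⟩ := ihr hr'.1 hr.1
    obtain ⟨d₂, e₂⟩ := ihs hr'.2 hr.2
    refine ⟨⟨d₁, d₂⟩, ?_⟩
    simp only [RatExpr.eval, delta, map_add]
    rw [e₁, e₂, fromBlocks_add, add_zero]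
  | mul r s ihr ihs =>
    obtain ⟨d₁, e₁⟩ := ihr hr'.1 hr.1
    obtain ⟨d₂, e₂⟩ := ihs hr'.2 hr.2
    refine ⟨⟨d₁, d₂⟩, ?_⟩
    simp only [RatExpr.eval, delta, map_add]
    rw [e₁, e₂, fromBlocks_multiply, H' r hr'.1, H s hr.2, compress_blowUp_mul,
      compress_mul_blowUp]
    simp
  | inv r ihr =>
    obtain ⟨d, h⟩ := ihr hr'.1 hr.1
    obtain ⟨hu, hinv⟩ := isUnit_fromBlocks_upper
      (compress e' e q p ((delta i j r).eval b)) hr'.2 hr.2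
    refine ⟨⟨d, by rw [h]; exact hu⟩, ?_⟩
    have K' := H' (.inv r) hr'
    have K := H (.inv r) hr
    simp only [RatExpr.eval, RatExpr.rename] at K' K
    simp only [RatExpr.eval, delta, RatExpr.neg]
    rw [h, hinv, K', K, map_neg, map_one, neg_one_mul, map_neg, compress_mul_blowUp,
      compress_blowUp_mul]

end BlockTriangular

/-! ### Block upper triangular points of multipartite tuples -/

section BlockPoint

open Matrix

/-- Index sets of a block decomposition: either the disjoint union of `Fin n'` and `Fin n` (if `p`
holds), or their identification (otherwise). -/
theorem exists_fin_glue (p : Prop) (n' n : ℕ) (h : ¬ p → n' = n) :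
    ∃ (N : ℕ) (α' : Fin n' → Fin N) (α : Fin n → Fin N),
      Function.Injective α' ∧ Function.Injective α ∧
      (p → Function.Bijective (Sum.elim α' α)) ∧
      (¬ p → (∀ x y, α' x = α y ↔ x.val = y.val) ∧
        Function.Surjective α' ∧ Function.Bijective α) := by
  by_cases hp : p
  · refine ⟨n' + n, Fin.castAdd n, Fin.natAdd n', Fin.castAdd_injective _ _,
      Fin.natAdd_injective _ _, fun _ => ?_, fun hn => absurd hp hn⟩
    convert (finSumFinEquiv (m := n') (n := n)).bijective using 1
    funext x
    cases x <;> rfl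
  · obtain rfl := h hp
    exact ⟨n', id, id, Function.injective_id, Function.injective_id, fun h => absurd h hp,
      fun _ => ⟨fun _ _ => Fin.ext_iff, Function.surjective_id, Function.bijective_id⟩⟩

variable {k : Type*} [Field k] {ι V : Type} [Fintype ι] [DecidableEq ι]

/-- Two tuples of matrices that agree outside the `i`-th part are the diagonal blocks of a tuple
whose `i`-th part is block upper triangular with arbitrary blocks `C v` off the diagonal. -/
theorem exists_block_point (π : V → ι) (i : ι) {n' n : ι → ℕ} (hn : ∀ l, l ≠ i → n' l = n l)
    (hpos : ∀ l, 0 < n l) (a' : MPPoint k π n') (a : MPPoint k π n)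
    (hag : ∀ v, π v ≠ i → ∀ (x' y' : Fin (n' (π v))) (x y : Fin (n (π v))),
      x'.val = x.val → y'.val = y.val → a' v x' y' = a v x y)
    (C : (v : V) → Fin (n' (π v)) → Fin (n (π v)) → k) :
    ∃ N : ι → ℕ, (∀ l, 0 < N l) ∧
      ∃ (ψ : ((l : ι) → Fin (n' l)) ⊕ ((l : ι) → Fin (n l)) ≃ ((l : ι) → Fin (N l)))
        (c : MPPoint k π N), ∀ v, (kronTuple π c v).submatrix ψ ψ =
          fromBlocks (kronTuple π a' v)
            (Matrix.of fun s t => if π v = i ∧ ∀ l, l ≠ i → (s l).val = (t l).val then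
              C v (s (π v)) (t (π v)) else 0) 0 (kronTuple π a v) := by
  choose N α' α hα' hα hsum hglue using fun l => exists_fin_glue (l = i) (n' l) (n l) (hn l)
  have hne : ∀ x y, α' i x ≠ α i y := fun x y hxy => by
    simpa using (hsum i rfl).1 (a₁ := Sum.inl x) (a₂ := Sum.inr y) hxy
  have hblock : ∀ v, ∃ A : Matrix (Fin (N (π v))) (Fin (N (π v))) k,
      (∀ x y, A (α' _ x) (α' _ y) = a' v x y) ∧ (∀ x y, A (α _ x) (α _ y) = a v x y) ∧
      (π v = i → (∀ x y, A (α' _ x) (α _ y) = C v x y) ∧ ∀ x y, A (α _ x) (α' _ y) = 0) := by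
    intro v
    by_cases hv : π v = i
    · let σ := Equiv.ofBijective _ (hsum _ hv)
      have h1 : ∀ x, σ.symm (α' _ x) = Sum.inl x := fun x => σ.symm_apply_apply (Sum.inl x)
      have h2 : ∀ x, σ.symm (α _ x) = Sum.inr x := fun x => σ.symm_apply_apply (Sum.inr x)
      refine ⟨(fromBlocks (a' v) (Matrix.of (C v)) 0 (a v)).submatrix σ.symm σ.symm, ?_, ?_,
        fun _ => ⟨?_, ?_⟩⟩ <;> intro x y <;> simp [h1, h2]
    · obtain ⟨heq, -, hb⟩ := hglue _ hv
      let σ := Equiv.ofBijective _ hb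
      have h2 : ∀ x, σ.symm (α _ x) = x := fun x => σ.symm_apply_apply x
      have h1 : ∀ x, (σ.symm (α' _ x)).val = x.val := fun x =>
        ((heq _ _).1 (σ.apply_symm_apply _).symm).symm
      refine ⟨(a v).submatrix σ.symm σ.symm, ?_, ?_, fun h => absurd h hv⟩
      · intro x y
        exact (hag v hv _ _ _ _ (h1 x).symm (h1 y).symm).symm
      · intro x y
        simp [h2]
  choose c hc' hc hci using hblock
  let ψ₀ : ((l : ι) → Fin (n' l)) ⊕ ((l : ι) → Fin (n l)) → ((l : ι) → Fin (N l)) :=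
    Sum.elim (fun s l => α' l (s l)) (fun t l => α l (t l))
  have hψ : Function.Bijective ψ₀ := by
    constructor
    · rintro (s | s) (t | t) h
      · exact congrArg Sum.inl (funext fun l => hα' l (congrFun h l))
      · exact absurd (congrFun h i) (hne _ _)
      · exact absurd (congrFun h i).symm (hne _ _)
      · exact congrArg Sum.inr (funext fun l => hα l (congrFun h l))
    · intro z
      obtain ⟨x | x, hx⟩ := (hsum i rfl).2 (z i)
      · have : ∀ l, ∃ x, α' l x = z l := fun l => by
          by_cases hl : l = i
          · subst hl; exact ⟨x, hx⟩
          · exact (hglue l hl).2.1 _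
        choose s hs using this
        exact ⟨Sum.inl s, funext hs⟩
      · have : ∀ l, ∃ x, α l x = z l := fun l => by
          by_cases hl : l = i
          · subst hl; exact ⟨x, hx⟩
          · exact (hglue l hl).2.2.2 _
        choose s hs using this
        exact ⟨Sum.inr s, funext hs⟩
  refine ⟨N, fun l => (α l ⟨0, hpos l⟩).pos, Equiv.ofBijective ψ₀ hψ, c, fun v => ?_⟩
  ext (s | s) (t | t)
  · simp [kronTuple, kronEmb_apply, ψ₀, hc', (hα' _).eq_iff]
  · simp only [kronTuple, kronEmb_apply, ψ₀, submatrix_apply, Equiv.ofBijective_apply,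
      Sum.elim_inl, Sum.elim_inr, fromBlocks_apply₁₂, of_apply]
    by_cases hv : π v = i
    · rw [(hci v hv).1]
      refine if_congr ?_ rfl rfl
      subst hv
      simp only [true_and]
      exact forall₂_congr fun l hl => (hglue l hl).1 _ _
    · rw [if_neg fun h => hne _ _ (h i (Ne.symm hv)), if_neg fun h => hv h.1]
  · simp only [kronTuple, kronEmb_apply, ψ₀, submatrix_apply, Equiv.ofBijective_apply,
      Sum.elim_inl, Sum.elim_inr, fromBlocks_apply₂₁, Matrix.zero_apply]
    by_cases hv : π v = i
    · rw [(hci v hv).2, ite_self]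
    · rw [if_neg fun h => hne _ _ (h i (Ne.symm hv)).symm]
  · simp [kronTuple, kronEmb_apply, ψ₀, hc, (hα _).eq_iff]

end BlockPoint

/-! ### The induced derivation -/

section Derivation

open Matrix

variable {G : ℕ} {g : Fin G → ℕ}

theorem primePart_self (i : Fin G) : primePart i i = i.castSucc := if_pos rfl

theorem primePart_of_ne {i l : Fin G} (h : l ≠ i) : primePart i l = i.castSucc.succAbove l :=
  if_neg h

theorem succAbove_self_notMem_range_primePart (i : Fin G) :
    i.castSucc.succAbove i ∉ Set.range (primePart i) := by
  rintro ⟨l, hl⟩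
  by_cases h : l = i
  · subst h
    rw [primePart_self] at hl
    exact Fin.succAbove_ne _ _ hl.symm
  · rw [primePart_of_ne h] at hl
    exact h (Fin.succAbove_right_injective hl)

theorem castSucc_notMem_range_succAbove (i : Fin G) :
    i.castSucc ∉ Set.range (Fin.succAboveEmb i.castSucc) := by
  rintro ⟨l, hl⟩
  exact Fin.succAbove_ne _ _ hl

/-- The compression of the identity matrix is an elementary matrix `E_{pq}` in the `i`-th tensor
factor, and the identity in the other factors. -/
theorem compress_one_apply {k : Type*} [Field k] (i : Fin G) (m : Fin (G + 1) → ℕ)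
    (q : (c : {c // c ∉ Set.range (primePart i)}) → Fin (m c))
    (p : (c : {c // c ∉ Set.range (Fin.succAboveEmb i.castSucc)}) → Fin (m c))
    (s : (l : Fin G) → Fin (m (primePart i l)))
    (t : (l : Fin G) → Fin (m (Fin.succAboveEmb i.castSucc l))) :
    compress (k := k) (embSplit (primePart i) m) (embSplit (Fin.succAboveEmb i.castSucc) m) q p 1
        s t =
      if (∀ l, l ≠ i → (s l).val = (t l).val) ∧
        ((s i).val = (p ⟨i.castSucc, castSucc_notMem_range_succAbove i⟩).val ∧
        (t i).val = (q ⟨_, succAbove_self_notMem_range_primePart i⟩).val) then 1 else 0 := by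
  rw [compress_apply, Matrix.one_apply]
  refine if_congr ?_ rfl rfl
  obtain ⟨x, hx⟩ := (embSplit (primePart i) m).surjective (s, q)
  obtain ⟨y, hy⟩ := (embSplit (Fin.succAboveEmb i.castSucc) m).surjective (t, p)
  rw [← hx, ← hy, Equiv.symm_apply_apply, Equiv.symm_apply_apply]
  rw [embSplit_apply, Prod.mk.injEq] at hx hy
  obtain ⟨rfl, rfl⟩ := hx
  obtain ⟨rfl, rfl⟩ := hy
  have hval : ∀ {c c' : Fin (G + 1)}, c = c' → (x c).val = (x c').val := by rintro c _ rfl; rfl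
  rw [funext_iff, Fin.forall_iff_succAbove i.castSucc]
  simp only [Fin.ext_iff, Fin.coe_succAboveEmb]
  rw [hval (primePart_self i)]
  constructor
  · rintro ⟨h1, h2⟩
    exact ⟨fun l hl => by rw [hval (primePart_of_ne hl), h2], h1, (h2 i).symm⟩
  · rintro ⟨h1, h2, h3⟩
    refine ⟨h2, fun l => ?_⟩
    by_cases hl : l = i
    · subst hl; exact h3.symm
    · rw [← h1 l hl, hval (primePart_of_ne hl)]

/-- Outside the `i`-th part, the restrictions of a tuple along the two copies of `X` agree. -/
theorem pullPoint_prime_eq {k : Type*} (i : Fin G) {m : Fin (G + 1) → ℕ}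
    (b : MPPoint k (mpPartExt g i) m) (v : MPVar g) (hv : mpPart g v ≠ i)
    (x' y' : Fin ((m ∘ primePart i) (mpPart g v)))
    (x y : Fin ((m ∘ Fin.succAboveEmb i.castSucc) (mpPart g v)))
    (hx : x'.val = x.val) (hy : y'.val = y.val) :
    pullPoint (primeVar g i) (primePart i) (mpPartExt_primeVar g i) b v x' y' =
      pullPoint (ρ := mpPartExt g i) Sum.inr (Fin.succAboveEmb i.castSucc) (fun _ => rfl) b
        v x y := by
  have key : ∀ w w' : MPVarExt g i, w = w' → ∀ (x' y' : Fin (m (mpPartExt g i w)))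
      (x y : Fin (m (mpPartExt g i w'))), x'.val = x.val → y'.val = y.val →
      b w x' y' = b w' x y := by
    rintro w _ rfl x' y' x y hx hy
    rw [Fin.ext hx, Fin.ext hy]
  exact key _ _ (dif_neg hv) _ _ _ _ hx hy

variable {k : Type*} [Field k] [CharZero k]

/-- The two copies of `r`, in `X'^(i)` and in `X^(i)`, are both defined at some common tuple. -/
theorem MPNondegenerate.delta (i : Fin G) (j : Fin (g i)) {r : RatExpr k (MPVar g)}
    (hr : MPNondegenerate (mpPart g) r) : MPNondegenerate (mpPartExt g i) (delta i j r) := by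
  obtain ⟨n, hn, b, hb', hb⟩ := MPNondegenerate.common (mpPartExt g i)
    (hr.rename (primeVar g i) (primeVar_injective g i) (primePart i) (mpPartExt_primeVar g i))
    (hr.rename (ρ := mpPartExt g i) Sum.inr Sum.inr_injective (Fin.succAboveEmb i.castSucc)
      fun _ => rfl)
  exact ⟨n, hn, b, (definedAt_delta_iff i j _ r).2 ⟨hb', hb⟩⟩

/-- If `r` and `s` agree at block upper triangular points, so do their off-diagonal blocks, that is,
all compressions of `delta i j r` and `delta i j s`. -/
theorem MPEquiv.delta (i : Fin G) (j : Fin (g i)) {r s : RatExpr k (MPVar g)}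
    (h : MPEquiv (mpPart g) r s) :
    MPEquiv (mpPartExt g i) (delta i j r) (delta i j s) := by
  intro m hm b hr hs
  obtain ⟨hr', hr⟩ := (definedAt_delta_iff i j _ r).1 hr
  obtain ⟨hs', hs⟩ := (definedAt_delta_iff i j _ s).1 hs
  have hπ : ∀ v, mpPartExt g i (Sum.inr v) = Fin.succAboveEmb i.castSucc (mpPart g v) :=
    fun _ => rfl
  replace hr' := ((mp_rename _ _ (mpPartExt_primeVar g i) hm b r).1).1 hr'
  replace hs' := ((mp_rename _ _ (mpPartExt_primeVar g i) hm b s).1).1 hs'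
  replace hr := ((mp_rename _ _ hπ hm b r).1).1 hr
  replace hs := ((mp_rename _ _ hπ hm b s).1).1 hs
  set a' := pullPoint _ _ (mpPartExt_primeVar g i) b
  set a := pullPoint _ _ hπ b
  refine eq_of_compress_eq (embSplit (primePart i) m) (embSplit (Fin.succAboveEmb i.castSucc) m)
    fun q p => ?_
  -- The block `C v` is `E_{pq}` for the differentiated variable and `0` for the others.
  obtain ⟨N, hN, ψ, c, hc⟩ := exists_block_point (mpPart g) i
    (fun l hl => congrArg m (primePart_of_ne hl)) (fun l => hm _) a' a
    (pullPoint_prime_eq i b)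
    (fun v x y => if v = ⟨i, j⟩ ∧
      (x.val = (p ⟨i.castSucc, castSucc_notMem_range_succAbove i⟩).val ∧
        y.val = (q ⟨_, succAbove_self_notMem_range_primePart i⟩).val) then 1 else 0)
  have hblock : (fun v => fromBlocks (kronTuple (mpPart g) a' v)
      ((if v = ⟨i, j⟩ then (1 : k) else 0) • compress (embSplit (primePart i) m)
        (embSplit (Fin.succAboveEmb i.castSucc) m) q p 1) 0 (kronTuple (mpPart g) a v)) =
      Matrix.reindexAlgEquiv k k ψ.symm ∘ kronTuple (mpPart g) c := by
    funext v
    rw [Function.comp_apply, Matrix.coe_reindexAlgEquiv, Matrix.reindex_apply, Equiv.symm_symm,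
      hc]
    congr 1
    ext x y
    rw [Matrix.smul_apply, compress_one_apply]
    refine Eq.trans ?_ (Matrix.of_apply _ _ _).symm
    by_cases hv : v = ⟨i, j⟩
    · subst hv
      simp only [smul_eq_mul, true_and, if_true, one_mul, mpPart]
      rw [ite_and]
    · simp only [smul_eq_mul, zero_mul, hv, false_and, if_false, ite_self]
  have key : ∀ u : RatExpr k (MPVar g), MPDefinedAt (mpPart g) u a' →
      MPDefinedAt (mpPart g) u a → MPDefinedAt (mpPart g) u c ∧
      fromBlocks (mpEval (mpPart g) u a') (compress (embSplit (primePart i) m)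
        (embSplit (Fin.succAboveEmb i.castSucc) m) q p
        (mpEval (mpPartExt g i) (_root_.delta i j u) b)) 0 (mpEval (mpPart g) u a) =
      Matrix.reindexAlgEquiv k k ψ.symm (mpEval (mpPart g) u c) := by
    intro u hu' hu
    obtain ⟨d, e⟩ := eval_fromBlocks _ _ q p i j _ _ _
      (kronTuple_pullPoint _ _ (mpPartExt_primeVar g i) b) (kronTuple_pullPoint _ _ hπ b) u hu' hu
    rw [hblock] at d e
    have d' : u.DefinedAt (kronTuple (mpPart g) c) :=
      RatExpr.definedAt_of_map (Matrix.reindexAlgEquiv k k ψ.symm).toAlgHom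
        (fun x hx => (MulEquiv.isUnit_map (Matrix.reindexAlgEquiv k k ψ.symm)).1 hx) _ u d
    exact ⟨d', e.symm.trans (RatExpr.map_eval
      (Matrix.reindexAlgEquiv k k ψ.symm).toAlgHom _ u d').2⟩
  obtain ⟨dr, er⟩ := key r hr' hr
  obtain ⟨ds, es⟩ := key s hs' hs
  rw [h N hN c dr ds, ← es] at er
  exact (Matrix.fromBlocks_inj.1 er).2.1

/-- The derivation of mp rational functions induced by `delta i j`. -/
def mpDelta (i : Fin G) (j : Fin (g i)) : MPRatX k g →ₗ[k] MPRatExt k g i where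
  toFun := Quotient.map (fun r => ⟨delta i j r.1, r.2.delta i j⟩) (fun _ _ h => MPEquiv.delta i j h)
  map_add' x y := by
    obtain ⟨r, hr, rfl⟩ := MPRat.exists_rep x
    obtain ⟨s, hs, rfl⟩ := MPRat.exists_rep y
    rfl
  map_smul' c x := by
    obtain ⟨r, hr, rfl⟩ := MPRat.exists_rep x
    -- `delta i j (c * r)` is `c * delta i j r + 0 * r`
    exact MPRat.mk_eq_of_eval
      (hr := ((MPNondegenerate.const _ c).mul _ hr).delta i j)
      (hs := (MPNondegenerate.const _ c).mul _ (hr.delta i j)) fun n a => by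
        simp [delta, RatExpr.eval, RatExpr.rename]

end Derivation

end

theorem corollary5 {k : Type*} [Field k] [CharZero k] {G : ℕ} (g : Fin G → ℕ) (i : Fin G)
    (j : Fin (g i)) :
    ∃ hΔ : ∀ r : RatExpr k (MPVar g), MPNondegenerate (mpPart g) r →
        MPNondegenerate (mpPartExt g i) (delta i j r),
      (∀ r s : RatExpr k (MPVar g), MPNondegenerate (mpPart g) r → MPNondegenerate (mpPart g) s →
        MPEquiv (mpPart g) r s → MPEquiv (mpPartExt g i) (delta i j r) (delta i j s)) ∧
      ∃ D : MPRatX k g →ₗ[k] MPRatExt k g i,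
        (∀ (r : RatExpr k (MPVar g)) (hr : MPNondegenerate (mpPart g) r),
          D (MPRat.mk (mpPart g) r hr) = MPRatExt.mk k g i (delta i j r) (hΔ r hr)) ∧
        ∀ x y : MPRatX k g, D (x * y) = x • D y + D x <• y := by
  refine ⟨fun r hr => hr.delta i j, fun r s _ _ h => h.delta i j, mpDelta i j,
    fun r hr => rfl, fun x y => ?_⟩
  obtain ⟨r, hr, rfl⟩ := MPRat.exists_rep x
  obtain ⟨s, hs, rfl⟩ := MPRat.exists_rep y
  rfl
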